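/- Let $d\ge 1$, let $\Omega\subset\mathbb R^d$ be a non-empty bounded open set, and let $\gamma>0$. Let $$C_2=\max\Big\{C\in\mathbb R:\ C\int_\Omega v^2\,dx\le\int_\Omega|\nabla v|^2\,dx\ \text{ for all } v\in H_0^1(\Omega)\Big\}$$ be the Poincaré constant of $\Omega$; it is positive. Let $T>0$ and let $u$ be a weak solution of $$u_t-\Big(\int_\Omega u^2\,dx\Big)^{\gamma}\Delta u=0\ \text{ in }\Omega\times(0,T],\qquad u=0\ \text{ on }\partial\Omega\times(0,T],\qquad u(\cdot,0)=u_0\ \text{ in }\Omega,$$ that is, $u\in L_2(0,T;H_0^1(\Omega))$ with weak time derivative $u_t\in L_2(0,T;L_2(\Omega))$ (so that $u$ has a representative in $C([0,T];L_2(\Omega))$, which is the one used), $u(\cdot,0)=u_0$ almost everywhere in $\Omega$, and for almost every $t\in(0,T)$ $$\int_\Omega u_t\,w\,dx+\Big(\int_\Omega u^2\,dx\Big)^{\gamma}\int_\Omega\nabla u\cdot\nabla w\,dx=0\qquad\text{for all } w\in H_0^1(\Omega).$$ Then for every $t\in[0,T]$ $$\int_\Omega u(x,t)^2\,dx\le\frac{\int_\Omega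 u_0^2\,dx}{\Big(1+2C_2\gamma\big(\int_\Omega u_0^2\,dx\big)^{\gamma}\,t\Big)^{1/\gamma}}.$$ -/

import Mathlib

open MeasureTheory Set
open scoped ContDiff Gradient

noncomputable section

namespace NonlocalHeat

/-- Real-valued functions in `C_c^∞(U)`, extended by zero. -/
structure IsTestFunction {F : Type*} [NormedAddCommGroup F] [NormedSpace ℝ F]
    (U : Set F) (φ : F → ℝ) : Prop where
  smooth : ContDiff ℝ ∞ φ
  hasCompactSupport : HasCompactSupport φ
  tsupport_subset : tsupport φ ⊆ U

/-- `L²(Ω)`, real-valued. -/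
abbrev L2 {d : ℕ} (Ω : Set (EuclideanSpace ℝ (Fin d))) : Type :=
  Lp ℝ 2 (volume.restrict Ω)

/-- `L²(Ω; ℝ^d)`. -/
abbrev L2Vec {d : ℕ} (Ω : Set (EuclideanSpace ℝ (Fin d))) : Type :=
  Lp (EuclideanSpace ℝ (Fin d)) 2 (volume.restrict Ω)

/-- The Sobolev space `H¹(Ω)`, a function being listed together with its weak gradient:
the pairs `(v, ∇v)` with `∫_Ω v ∇φ = -∫_Ω φ ∇v` for all `φ ∈ C_c^∞(Ω)`. The topology induced by
`L²(Ω) × L²(Ω; ℝ^d)` is that of the `H¹` norm. -/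
def H1 {d : ℕ} (Ω : Set (EuclideanSpace ℝ (Fin d))) : Set (L2 Ω × L2Vec Ω) :=
  {p | ∀ φ : EuclideanSpace ℝ (Fin d) → ℝ, IsTestFunction Ω φ →
    ∫ x in Ω, p.1 x • ∇ φ x = -∫ x in Ω, φ x • p.2 x}

/-- The pairs `(φ, ∇φ)` with `φ ∈ C_c^∞(Ω)`. -/
def testPairs {d : ℕ} (Ω : Set (EuclideanSpace ℝ (Fin d))) : Set (L2 Ω × L2Vec Ω) :=
  {p | ∃ φ : EuclideanSpace ℝ (Fin d) → ℝ, IsTestFunction Ω φ ∧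
    p.1 =ᵐ[volume.restrict Ω] φ ∧ p.2 =ᵐ[volume.restrict Ω] ∇ φ}

/-- `H¹₀(Ω)`: the closure of `C_c^∞(Ω)` in `H¹(Ω)`, again as pairs `(v, ∇v)`. -/
def H10 {d : ℕ} (Ω : Set (EuclideanSpace ℝ (Fin d))) : Set (L2 Ω × L2Vec Ω) :=
  H1 Ω ∩ closure (testPairs Ω)

/-- `u ∈ L²(0,T; H¹₀(Ω))` with spatial weak gradient `g`. -/
structure MemL2H10 {d : ℕ} (Ω : Set (EuclideanSpace ℝ (Fin d))) (T : ℝ)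
    (u : ℝ → L2 Ω) (g : ℝ → L2Vec Ω) : Prop where
  memLp : MemLp u 2 (volume.restrict (Ioo 0 T))
  memLp_grad : MemLp g 2 (volume.restrict (Ioo 0 T))
  mem_H10 : ∀ᵐ t ∂(volume.restrict (Ioo 0 T)), (u t, g t) ∈ H10 Ω

/-- `∂u/∂t = u'` in the weak sense on `(0,T)`, with `u' ∈ L²(0,T; L²(Ω))`. The integrals are
Bochner integrals in `L²(Ω)`. -/
structure HasWeakTimeDeriv {d : ℕ} (Ω : Set (EuclideanSpace ℝ (Fin d))) (T : ℝ)
    (u u' : ℝ → L2 Ω) : Prop where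
  memLp : MemLp u' 2 (volume.restrict (Ioo 0 T))
  integral_eq : ∀ φ : ℝ → ℝ, IsTestFunction (Ioo 0 T) φ →
    ∫ t in Ioo 0 T, deriv φ t • u t = -∫ t in Ioo 0 T, φ t • u' t

/-- `u` is a weak solution on `Ω × [0,T]` of
`u_t - (∫_Ω u²)^γ Δu = f`, `u = 0` on `∂Ω`, `u(·,0) = u₀`.
A function with `u, u_t ∈ L²(0,T; L²(Ω))` has a unique representative in `C([0,T]; L²(Ω))`, through
which its values at single times, and so the initial condition, are understood; `u` is that
representative. -/
def IsWeakSolution {d : ℕ} (Ω : Set (EuclideanSpace ℝ (Fin d))) (T γ : ℝ)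
    (f : ℝ → L2 Ω) (u₀ : EuclideanSpace ℝ (Fin d) → ℝ) (u : ℝ → L2 Ω) : Prop :=
  ContinuousOn u (Icc 0 T) ∧
  u 0 =ᵐ[volume.restrict Ω] u₀ ∧
  ∃ (g : ℝ → L2Vec Ω) (u' : ℝ → L2 Ω),
    MemL2H10 Ω T u g ∧
    HasWeakTimeDeriv Ω T u u' ∧
    ∀ᵐ t ∂(volume.restrict (Ioo 0 T)), ∀ w ∈ H10 Ω,
      (∫ x in Ω, u' t x * w.1 x)
        + (∫ x in Ω, (u t x) ^ 2) ^ γ * (∫ x in Ω, inner ℝ (g t x) (w.2 x))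
        = ∫ x in Ω, f t x * w.1 x

/-- The Poincaré constant of `Ω`: the largest `C` with
`C ∫_Ω v² ≤ ∫_Ω |∇v|²` for all `v ∈ H¹₀(Ω)`. -/
def poincareConst {d : ℕ} (Ω : Set (EuclideanSpace ℝ (Fin d))) : ℝ :=
  sSup {C : ℝ | ∀ p ∈ H10 Ω, C * (∫ x in Ω, (p.1 x) ^ 2) ≤ ∫ x in Ω, ‖p.2 x‖ ^ 2}

end NonlocalHeat

end

/-! Put y(t) = ∫_Ω u(x,t)² dx. Testing the equation with w = u(t) gives y' = -2 y^γ ∫_Ω |∇u|², and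
Poincaré's inequality turns this into y' ≤ -2 C₂ y^(γ+1). Where y > 0 this reads (y^(-γ))' ≥ 2 C₂ γ;
integrating from 0 to t and solving for y(t) gives the bound.

The derivative of u is only weak, so the calculus needs y to be absolutely continuous.
`eq_add_integral_of_weakDeriv` recovers u as the Bochner primitive of its weak derivative;
`IsWeakSolution.energy_inequality` then gives the differential inequality almost everywhere, and
`le_div_rpow_of_deriv_le` integrates it. Positivity of C₂ follows from
`IsTestFunction.integral_sq_le` by passing to the closure. -/

/-! ### Weak time derivatives and the fundamental theorem of calculus -/

section TimeDerivative

open Filter Topology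
open scoped Convolution

namespace ContDiffBump

/-- The primitive of a normalised bump function centred at `0`: a smooth monotone step from
`0` to `1`. -/
noncomputable def smoothStep (ρ : ContDiffBump (0 : ℝ)) (x : ℝ) : ℝ :=
  ∫ y in (-ρ.rOut)..x, ρ.normed volume y

variable (ρ : ContDiffBump (0 : ℝ))

lemma hasDerivAt_smoothStep (x : ℝ) : HasDerivAt ρ.smoothStep (ρ.normed volume x) x :=
  (ρ.continuous_normed.integral_hasStrictDerivAt _ x).hasDerivAt

lemma contDiff_smoothStep : ContDiff ℝ ∞ ρ.smoothStep := by
  rw [contDiff_infty_iff_deriv]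
  refine ⟨fun x => (ρ.hasDerivAt_smoothStep x).differentiableAt, ?_⟩
  rw [show deriv ρ.smoothStep = ρ.normed volume from
    funext fun x => (ρ.hasDerivAt_smoothStep x).deriv]
  exact ρ.contDiff_normed

lemma monotone_smoothStep : Monotone ρ.smoothStep :=
  monotone_of_deriv_nonneg (fun x => (ρ.hasDerivAt_smoothStep x).differentiableAt) fun x => by
    rw [(ρ.hasDerivAt_smoothStep x).deriv]; exact ρ.nonneg_normed x

lemma smoothStep_eq_one {x : ℝ} (hx : ρ.rOut ≤ x) : ρ.smoothStep x = 1 := by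
  have hs : Function.support (ρ.normed volume) ⊆ Ioc (-ρ.rOut) x := by
    rw [ρ.support_normed_eq, Real.ball_eq_Ioo]
    intro y hy
    exact ⟨by linarith [hy.1], by linarith [hy.2]⟩
  rw [smoothStep, intervalIntegral.integral_eq_integral_of_support_subset hs, ρ.integral_normed]

lemma smoothStep_eq_zero {x : ℝ} (hx : x ≤ -ρ.rOut) : ρ.smoothStep x = 0 := by
  rw [smoothStep, intervalIntegral.integral_symm, neg_eq_zero]
  refine intervalIntegral.integral_zero_ae (Eventually.of_forall fun y hy => ?_)
  rw [uIoc_of_le hx] at hy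
  have : y ∉ Function.support (ρ.normed volume) := by
    rw [ρ.support_normed_eq, Real.ball_eq_Ioo]
    intro h
    linarith [h.1, hy.2]
  simpa using this

lemma smoothStep_nonneg (x : ℝ) : 0 ≤ ρ.smoothStep x := by
  rw [← ρ.smoothStep_eq_zero (min_le_right x (-ρ.rOut))]
  exact ρ.monotone_smoothStep (min_le_left _ _)

lemma smoothStep_le_one (x : ℝ) : ρ.smoothStep x ≤ 1 := by
  rw [← ρ.smoothStep_eq_one (le_max_right x ρ.rOut)]
  exact ρ.monotone_smoothStep (le_max_left _ _)

/-- A smooth approximation of the indicator function of `[s, t]`. -/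
noncomputable def smoothPlateau (s t x : ℝ) : ℝ := ρ.smoothStep (x - s) - ρ.smoothStep (x - t)

lemma hasDerivAt_smoothPlateau (s t x : ℝ) : HasDerivAt (ρ.smoothPlateau s t)
    (ρ.normed volume (x - s) - ρ.normed volume (x - t)) x :=
  ((ρ.hasDerivAt_smoothStep (x - s)).comp_sub_const x s).sub
    ((ρ.hasDerivAt_smoothStep (x - t)).comp_sub_const x t)

lemma abs_smoothPlateau_le_one (s t x : ℝ) : |ρ.smoothPlateau s t x| ≤ 1 := by
  rw [abs_le, smoothPlateau]
  constructor <;> linarith [ρ.smoothStep_nonneg (x - s), ρ.smoothStep_nonneg (x - t),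
    ρ.smoothStep_le_one (x - s), ρ.smoothStep_le_one (x - t)]

lemma tsupport_smoothPlateau_subset {s t : ℝ} (hst : s ≤ t) :
    tsupport (ρ.smoothPlateau s t) ⊆ Icc (s - ρ.rOut) (t + ρ.rOut) := by
  refine closure_minimal (fun x hx => ?_) isClosed_Icc
  by_contra h
  apply hx
  rw [mem_Icc, not_and_or, not_le, not_le] at h
  rcases h with h | h
  · simp [smoothPlateau, ρ.smoothStep_eq_zero (show x - s ≤ -ρ.rOut by linarith),
      ρ.smoothStep_eq_zero (show x - t ≤ -ρ.rOut by linarith)]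
  · simp [smoothPlateau, ρ.smoothStep_eq_one (show ρ.rOut ≤ x - s by linarith),
      ρ.smoothStep_eq_one (show ρ.rOut ≤ x - t by linarith)]

lemma isTestFunction_smoothPlateau {s t : ℝ} (hst : s ≤ t) {U : Set ℝ}
    (hU : Icc (s - ρ.rOut) (t + ρ.rOut) ⊆ U) :
    NonlocalHeat.IsTestFunction U (ρ.smoothPlateau s t) where
  smooth := (ρ.contDiff_smoothStep.comp (contDiff_id.sub contDiff_const)).sub
    (ρ.contDiff_smoothStep.comp (contDiff_id.sub contDiff_const))
  hasCompactSupport := isCompact_Icc.of_isClosed_subset (isClosed_tsupport _)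
    (ρ.tsupport_smoothPlateau_subset hst)
  tsupport_subset := (ρ.tsupport_smoothPlateau_subset hst).trans hU

lemma tendsto_smoothPlateau {ι : Type*} {l : Filter ι} {ρ : ι → ContDiffBump (0 : ℝ)}
    (hρ : Tendsto (fun i => (ρ i).rOut) l (𝓝 0)) {s t x : ℝ} (hst : s ≤ t) (hs : x ≠ s)
    (ht : x ≠ t) :
    Tendsto (fun i => (ρ i).smoothPlateau s t x) l (𝓝 ((Ioc s t).indicator 1 x)) := by
  have key : ∀ {y : ℝ}, y ≠ 0 →
      Tendsto (fun i => (ρ i).smoothStep y) l (𝓝 ((Ioi (0 : ℝ)).indicator 1 y)) := by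
    intro y hy
    apply tendsto_nhds_of_eventually_eq
    rcases lt_or_gt_of_ne hy with h | h
    · filter_upwards [hρ.eventually_lt_const (neg_pos.2 h)] with i hi
      rw [(ρ i).smoothStep_eq_zero (by linarith), indicator_of_notMem (by simpa using h.le)]
    · filter_upwards [hρ.eventually_lt_const h] with i hi
      rw [(ρ i).smoothStep_eq_one hi.le, indicator_of_mem (by simpa using h)]; rfl
  convert (key (sub_ne_zero.2 hs)).sub (key (sub_ne_zero.2 ht)) using 2
  · rfl
  · simp only [indicator, mem_Ioc, mem_Ioi, sub_pos, Pi.one_apply]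
    split_ifs <;> grind

end ContDiffBump

variable {E : Type*} [NormedAddCommGroup E] [NormedSpace ℝ E] [CompleteSpace E]

/-- Bumps shrinking to s act as a Dirac mass. Since the bump is even, the integral is a convolution
evaluated at s; once its support lies in (0, T), the way u is extended outside [0, T] is irrelevant.
-/
lemma tendsto_setIntegral_normed_smul {T s : ℝ} (hs : s ∈ Ioo 0 T) {u : ℝ → E}
    (hu : ContinuousOn u (Icc 0 T)) {ι : Type*} {l : Filter ι} {ρ : ι → ContDiffBump (0 : ℝ)}
    (hρ : Tendsto (fun i => (ρ i).rOut) l (𝓝 0)) :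
    Tendsto (fun i => ∫ x in Ioo 0 T, (ρ i).normed volume (x - s) • u x) l (𝓝 (u s)) := by
  have hT : (0 : ℝ) ≤ T := (hs.1.trans hs.2).le
  set v : ℝ → E := IccExtend hT ((Icc 0 T).domRestrict u) with hv
  have hvc : Continuous v := (continuousOn_iff_continuous_domRestrict.1 hu).Icc_extend'
  have hvu : ∀ x ∈ Icc 0 T, v x = u x := fun x hx => by
    rw [hv, IccExtend_of_mem _ _ hx]; rfl
  have := ContDiffBump.convolution_tendsto_right_of_continuous (μ := volume) hρ hvc s
  rw [hvu s (Ioo_subset_Icc_self hs)] at this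
  refine this.congr' ?_
  filter_upwards [hρ.eventually_lt_const hs.1, hρ.eventually_lt_const (sub_pos.2 hs.2)]
    with i h1 h2
  rw [convolution_eq_swap]
  symm
  rw [← integral_indicator measurableSet_Ioo]
  refine integral_congr_ae (Eventually.of_forall fun x => ?_)
  simp only [ContinuousLinearMap.lsmul_apply]
  by_cases hx : x ∈ Ioo 0 T
  · rw [indicator_of_mem hx, hvu x (Ioo_subset_Icc_self hx), ← (ρ i).normed_neg, neg_sub]
  · rw [indicator_of_notMem hx]
    have : s - x ∉ Function.support ((ρ i).normed volume) := by
      rw [(ρ i).support_normed_eq, Real.ball_eq_Ioo]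
      intro h
      exact hx ⟨by linarith [h.2], by linarith [h.1]⟩
    rw [Function.notMem_support.1 this, zero_smul]

/-- A continuous function with an integrable weak derivative on `(0, T)` is the integral of that
derivative. -/
lemma sub_eq_integral_of_weakDeriv {T : ℝ} {u u' : ℝ → E} (hu : ContinuousOn u (Icc 0 T))
    (hu' : IntegrableOn u' (Ioo 0 T))
    (h : ∀ φ : ℝ → ℝ, NonlocalHeat.IsTestFunction (Ioo 0 T) φ →
      ∫ t in Ioo 0 T, deriv φ t • u t = -∫ t in Ioo 0 T, φ t • u' t)
    {s t : ℝ} (hs : 0 < s) (hst : s ≤ t) (ht : t < T) :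
    u t - u s = ∫ x in s..t, u' x := by
  have hsT : s ∈ Ioo 0 T := ⟨hs, hst.trans_lt ht⟩
  have htT : t ∈ Ioo 0 T := ⟨hs.trans_le hst, ht⟩
  let ρ : ℕ → ContDiffBump (0 : ℝ) := fun n =>
    ⟨1 / ((n : ℝ) + 1) / 2, 1 / ((n : ℝ) + 1), by positivity, half_lt_self (by positivity)⟩
  have hρ : Tendsto (fun n => (ρ n).rOut) atTop (𝓝 0) := tendsto_one_div_add_atTop_nhds_zero_nat
  have huint : IntegrableOn u (Ioo 0 T) :=
    (hu.integrableOn_compact isCompact_Icc).mono_set Ioo_subset_Icc_self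
  have hint : ∀ (n : ℕ) (r : ℝ),
      IntegrableOn (fun x => (ρ n).normed volume (x - r) • u x) (Ioo 0 T) := by
    intro n r
    refine ((ContinuousOn.smul ?_ hu).integrableOn_compact isCompact_Icc).mono_set
      Ioo_subset_Icc_self
    exact ((ρ n).continuous_normed.comp (continuous_id.sub continuous_const)).continuousOn
  -- The derivative of the plateau is an approximate Dirac mass at s minus one at t.
  have hA : Tendsto (fun n => ∫ x in Ioo 0 T, deriv ((ρ n).smoothPlateau s t) x • u x) atTop
      (𝓝 (u s - u t)) := by
    refine ((tendsto_setIntegral_normed_smul hsT hu hρ).sub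
      (tendsto_setIntegral_normed_smul htT hu hρ)).congr fun n => ?_
    rw [← integral_sub (hint n s) (hint n t)]
    refine integral_congr_ae (Eventually.of_forall fun x => ?_)
    simp only [((ρ n).hasDerivAt_smoothPlateau s t x).deriv, sub_smul]
  have hB : Tendsto (fun n => ∫ x in Ioo 0 T, (ρ n).smoothPlateau s t x • u' x) atTop
      (𝓝 (∫ x in Ioo 0 T, (Ioc s t).indicator (1 : ℝ → ℝ) x • u' x)) := by
    refine tendsto_integral_of_dominated_convergence (fun x => ‖u' x‖) (fun n => ?_) hu'.norm
      (fun n => Eventually.of_forall fun x => ?_) ?_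
    · refine AEStronglyMeasurable.smul ?_ hu'.aestronglyMeasurable
      exact (continuous_iff_continuousAt.2 fun x =>
        ((ρ n).hasDerivAt_smoothPlateau s t x).continuousAt).aestronglyMeasurable
    · rw [norm_smul, Real.norm_eq_abs]
      exact mul_le_of_le_one_left (norm_nonneg _) ((ρ n).abs_smoothPlateau_le_one s t x)
    · have h1 : ∀ᵐ x ∂(volume.restrict (Ioo 0 T)), x ≠ s := ae_restrict_of_ae (by
        simp [ae_iff, measure_singleton])
      have h2 : ∀ᵐ x ∂(volume.restrict (Ioo 0 T)), x ≠ t := ae_restrict_of_ae (by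
        simp [ae_iff, measure_singleton])
      filter_upwards [h1, h2] with x hx1 hx2
      exact (ContDiffBump.tendsto_smoothPlateau hρ hst hx1 hx2).smul_const _
  have hAB : ∀ᶠ n in atTop, ∫ x in Ioo 0 T, deriv ((ρ n).smoothPlateau s t) x • u x =
      -∫ x in Ioo 0 T, (ρ n).smoothPlateau s t x • u' x := by
    filter_upwards [hρ.eventually_lt_const hs, hρ.eventually_lt_const (sub_pos.2 ht)] with n h1 h2
    exact h _ ((ρ n).isTestFunction_smoothPlateau hst fun x hx =>
      ⟨by linarith [hx.1], by linarith [hx.2]⟩)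
  have hlim := tendsto_nhds_unique (hA.congr' hAB) hB.neg
  rw [← neg_sub, hlim, neg_neg, intervalIntegral.integral_of_le hst]
  have : ∀ x, (Ioc s t).indicator (1 : ℝ → ℝ) x • u' x = (Ioc s t).indicator u' x := by
    intro x
    by_cases hx : x ∈ Ioc s t <;> simp [hx]
  simp_rw [this]
  rw [setIntegral_indicator measurableSet_Ioc, inter_eq_right.2]
  exact fun x hx => ⟨hs.trans hx.1, hx.2.trans_lt ht⟩

end TimeDerivative

/-! ### Absolute continuity and the differential inequality -/

section Energy

open Filter Topology

lemma AbsolutelyContinuousOnInterval.of_dist_le {X Y : Type*} [PseudoMetricSpace X]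
    [PseudoMetricSpace Y] {f : ℝ → X} {g : ℝ → Y} {a b K : ℝ}
    (hg : AbsolutelyContinuousOnInterval g a b)
    (h : ∀ x ∈ uIcc a b, ∀ y ∈ uIcc a b, dist (f x) (f y) ≤ K * dist (g x) (g y)) :
    AbsolutelyContinuousOnInterval f a b := by
  have hK : Tendsto (fun E : ℕ × (ℕ → ℝ × ℝ) =>
      K * ∑ i ∈ Finset.range E.1, dist (g (E.2 i).1) (g (E.2 i).2))
      (totalLengthFilter ⊓ 𝓟 (disjWithin a b)) (𝓝 0) := by
    simpa using Tendsto.const_mul K hg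
  refine squeeze_zero' (Eventually.of_forall fun E => Finset.sum_nonneg fun i _ => dist_nonneg)
    ?_ hK
  refine Eventually.filter_mono inf_le_right (eventually_principal.2 fun E hE => ?_)
  rw [Finset.mul_sum]
  exact Finset.sum_le_sum fun i hi => h _ (hE.1 i hi).1 _ (hE.1 i hi).2

lemma AbsolutelyContinuousOnInterval.lipschitzOnWith_comp {X Y : Type*} [PseudoMetricSpace X]
    [PseudoMetricSpace Y] {f : ℝ → X} {g : X → Y} {s : Set X} {K : NNReal} {a b : ℝ}
    (hf : AbsolutelyContinuousOnInterval f a b) (hg : LipschitzOnWith K g s)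
    (hs : ∀ x ∈ uIcc a b, f x ∈ s) : AbsolutelyContinuousOnInterval (fun x => g (f x)) a b :=
  hf.of_dist_le fun x hx y hy => hg.dist_le_mul _ (hs x hx) _ (hs y hy)

lemma AbsolutelyContinuousOnInterval.norm_sq {E : Type*} [NormedAddCommGroup E] {u : ℝ → E}
    {a b : ℝ} (hu : AbsolutelyContinuousOnInterval u a b) :
    AbsolutelyContinuousOnInterval (fun x => ‖u x‖ ^ 2) a b := by
  have hn : AbsolutelyContinuousOnInterval (fun x => ‖u x‖) a b :=
    hu.of_dist_le (K := 1) fun x _ y _ => by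
      simpa [dist_eq_norm] using abs_norm_sub_norm_le (u x) (u y)
  simpa only [sq, Pi.mul_def] using hn.mul hn

variable {E : Type*} [NormedAddCommGroup E] [NormedSpace ℝ E]

/-- Increments of u are dominated by those of the real-valued primitive of ‖u'‖, which is absolutely
continuous. -/
lemma IntervalIntegrable.absolutelyContinuousOnInterval_of_sub_eq {u u' : ℝ → E} {a b : ℝ}
    (hu' : IntervalIntegrable u' volume a b)
    (h : ∀ x ∈ uIcc a b, u x = u a + ∫ y in a..x, u' y) :
    AbsolutelyContinuousOnInterval u a b := by
  refine (hu'.norm.absolutelyContinuousOnInterval_intervalIntegral left_mem_uIcc).of_dist_le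
    (K := 1) fun x hx y hy => ?_
  have hx' := hu'.mono_set (uIcc_subset_uIcc left_mem_uIcc hx)
  have hy' := hu'.mono_set (uIcc_subset_uIcc left_mem_uIcc hy)
  rw [h x hx, h y hy, dist_add_left, dist_eq_norm, intervalIntegral.integral_interval_sub_left
    hx' hy', one_mul, Real.dist_eq, intervalIntegral.integral_interval_sub_left hx'.norm hy'.norm]
  exact intervalIntegral.norm_integral_le_abs_integral_norm

variable [CompleteSpace E]

/-- A continuous function with an integrable weak derivative on `(0, T)` is the integral of that
derivative up to the endpoints. -/
lemma eq_add_integral_of_weakDeriv {T : ℝ} (hT : 0 < T) {u u' : ℝ → E}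
    (hu : ContinuousOn u (Icc 0 T)) (hu' : IntegrableOn u' (Ioo 0 T))
    (h : ∀ φ : ℝ → ℝ, NonlocalHeat.IsTestFunction (Ioo 0 T) φ →
      ∫ t in Ioo 0 T, deriv φ t • u t = -∫ t in Ioo 0 T, φ t • u' t) :
    ∀ t ∈ Icc 0 T, u t = u 0 + ∫ x in 0..t, u' x := by
  have hint : IntervalIntegrable u' volume 0 T := by
    rwa [intervalIntegrable_iff_integrableOn_Ioo_of_le hT.le]
  have hsub : ∀ {x : ℝ}, x ∈ Icc 0 T → IntervalIntegrable u' volume 0 x := fun hx =>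
    hint.mono_set (uIcc_subset_uIcc left_mem_uIcc (by rwa [uIcc_of_le hT.le]))
  -- This difference is constant on the open interval; continuity carries the constant to both
  -- endpoints.
  have hc : ContinuousOn (fun x => u x - ∫ y in 0..x, u' y) (Icc 0 T) := by
    have := intervalIntegral.continuousOn_primitive_interval' hint left_mem_uIcc
    rw [uIcc_of_le hT.le] at this
    exact hu.sub this
  have hmid : T / 2 ∈ Ioo 0 T := ⟨by linarith, by linarith⟩
  have hconst : EqOn (fun x => u x - ∫ y in 0..x, u' y)
      (fun _ => u (T / 2) - ∫ y in 0..(T / 2), u' y) (Ioo 0 T) := by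
    have key : ∀ x ∈ Ioo 0 T, ∀ y ∈ Ioo 0 T, x ≤ y →
        u x - (∫ z in 0..x, u' z) = u y - ∫ z in 0..y, u' z := by
      intro x hx y hy hxy
      have h1 := sub_eq_integral_of_weakDeriv hu hu' h hx.1 hxy hy.2
      rw [← intervalIntegral.integral_interval_sub_left (hsub (Ioo_subset_Icc_self hy))
        (hsub (Ioo_subset_Icc_self hx))] at h1
      rw [sub_eq_sub_iff_sub_eq_sub, ← neg_sub (u y), h1, neg_sub]
    intro x hx
    rcases le_total x (T / 2) with h' | h'
    · exact key x hx _ hmid h'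
    · exact (key _ hmid x hx h').symm
  have hall := hconst.of_subset_closure hc continuousOn_const Ioo_subset_Icc_self
    (closure_Ioo hT.ne).ge
  intro t ht
  have h1 := (hall ht).trans (hall (left_mem_Icc.2 hT.le)).symm
  simp only [intervalIntegral.integral_same, sub_zero] at h1
  exact sub_eq_iff_eq_add.1 h1

lemma ae_hasDerivAt_of_eq_add_integral {T : ℝ} (hT : 0 < T) {u u' : ℝ → E}
    (hu' : IntegrableOn u' (Ioo 0 T)) (h : ∀ t ∈ Icc 0 T, u t = u 0 + ∫ x in 0..t, u' x) :
    ∀ᵐ t, t ∈ Ioo 0 T → HasDerivAt u (u' t) t := by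
  have hint : IntervalIntegrable u' volume 0 T := by
    rwa [intervalIntegrable_iff_integrableOn_Ioo_of_le hT.le]
  filter_upwards [hint.ae_hasDerivAt_integral] with t ht htT
  have := ht (by rw [uIcc_of_le hT.le]; exact Ioo_subset_Icc_self htT) 0 left_mem_uIcc
  refine (this.const_add (u 0)).congr_of_eventuallyEq ?_
  filter_upwards [Ioo_mem_nhds htT.1 htT.2] with s hs
  exact h s (Ioo_subset_Icc_self hs)

lemma AbsolutelyContinuousOnInterval.mul_sub_le_sub {f : ℝ → ℝ} {a b c : ℝ} (hab : a ≤ b)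
    (hf : AbsolutelyContinuousOnInterval f a b) (h : ∀ᵐ x, x ∈ Ioo a b → c ≤ deriv f x) :
    c * (b - a) ≤ f b - f a := by
  rw [← hf.integral_deriv_eq_sub]
  calc c * (b - a) = ∫ _ in a..b, c := by simp [mul_comm]
    _ ≤ ∫ x in a..b, deriv f x := by
      rw [intervalIntegral.integral_of_le hab, intervalIntegral.integral_of_le hab,
        integral_Ioc_eq_integral_Ioo, integral_Ioc_eq_integral_Ioo]
      refine setIntegral_mono_on_ae ?_ ?_ measurableSet_Ioo h
      · exact integrableOn_const (by simp)
      · exact (intervalIntegrable_iff_integrableOn_Ioo_of_le hab).1 hf.intervalIntegrable_deriv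

/-- Comparison with the solution of `y' = -2 C y ^ (γ + 1)`. -/
lemma le_div_rpow_of_deriv_le {T C γ : ℝ} (hC : 0 ≤ C) (hγ : 0 < γ) {f : ℝ → ℝ}
    (hf : AbsolutelyContinuousOnInterval f 0 T) (hf0 : ∀ t, 0 ≤ f t)
    (h : ∀ᵐ t, t ∈ Ioo 0 T → deriv f t ≤ -(2 * C * (f t ^ γ * f t)))
    {t : ℝ} (ht : t ∈ Icc 0 T) :
    f t ≤ f 0 / (1 + 2 * C * γ * f 0 ^ γ * t) ^ (1 / γ) := by
  have hD : 0 < 1 + 2 * C * γ * f 0 ^ γ * t := by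
    have := Real.rpow_nonneg (hf0 0) γ
    have := ht.1
    positivity
  rcases (hf0 t).eq_or_lt with h0 | hpos
  · rw [← h0]
    exact div_nonneg (hf0 0) (Real.rpow_nonneg hD.le _)
  -- Monotonicity keeps f above f t > 0 on [0, t], away from the singularity of x ^ (-γ), which is
  -- therefore Lipschitz on the range of f.
  have hmono : ∀ s ∈ Icc 0 T, ∀ r ∈ Icc 0 T, s ≤ r → f r ≤ f s := by
    intro s hs r hr hsr
    have hac : AbsolutelyContinuousOnInterval f s r := hf.mono (by
      rw [uIcc_of_le hsr, uIcc_of_le (hs.1.trans hs.2)]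
      exact Icc_subset_Icc hs.1 hr.2)
    have := hac.neg.mul_sub_le_sub (c := 0) hsr (by
      filter_upwards [h] with x hx hxm
      have h1 := hx ⟨hs.1.trans_lt hxm.1, hxm.2.trans_le hr.2⟩
      have h2 : 0 ≤ 2 * C * (f x ^ γ * f x) :=
        mul_nonneg (by positivity) (mul_nonneg (Real.rpow_nonneg (hf0 x) _) (hf0 x))
      rw [deriv.neg]
      linarith)
    simp only [Pi.neg_apply] at this
    linarith
  have h0T : (0 : ℝ) ∈ Icc 0 T := ⟨le_rfl, ht.1.trans ht.2⟩
  have hac : AbsolutelyContinuousOnInterval f 0 t := hf.mono (by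
    rw [uIcc_of_le ht.1, uIcc_of_le h0T.2]
    exact Icc_subset_Icc le_rfl ht.2)
  have hmem : ∀ s ∈ Icc 0 t, f s ∈ Icc (f t) (f 0) := fun s hs =>
    ⟨hmono s ⟨hs.1, hs.2.trans ht.2⟩ t ht hs.2, hmono 0 h0T s ⟨hs.1, hs.2.trans ht.2⟩ hs.1⟩
  have hf0pos : 0 < f 0 := hpos.trans_le (hmem 0 ⟨le_rfl, ht.1⟩).1
  obtain ⟨K, hK⟩ := ContDiffOn.exists_lipschitzOnWith (f := fun x : ℝ => x ^ (-γ))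
    (s := Icc (f t) (f 0)) (n := 1) (fun x hx =>
      (Real.contDiffAt_rpow_const_of_ne (hpos.trans_le hx.1).ne').contDiffWithinAt)
    one_ne_zero (convex_Icc _ _) isCompact_Icc
  have hF := hac.lipschitzOnWith_comp hK (by rwa [uIcc_of_le ht.1])
  have hgrow := hF.mul_sub_le_sub (c := 2 * C * γ) ht.1 (by
    filter_upwards [h, hac.ae_differentiableAt] with x hx hdx hxt
    have hxm : x ∈ Icc 0 t := Ioo_subset_Icc_self hxt
    have hxpos : 0 < f x := hpos.trans_le (hmem x hxm).1
    have hd := (hdx (by rwa [uIcc_of_le ht.1])).hasDerivAt.rpow_const (p := -γ) (Or.inl hxpos.ne')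
    rw [hd.deriv]
    have h1 := hx ⟨hxt.1, hxt.2.trans_le ht.2⟩
    have h2 : 0 ≤ γ * f x ^ (-γ - 1) := by positivity
    have h3 : f x ^ (-γ - 1) * (f x ^ γ * f x) = 1 := by
      rw [← Real.rpow_add_one hxpos.ne', ← Real.rpow_add hxpos,
        show -γ - 1 + (γ + 1) = 0 by ring, Real.rpow_zero]
    have h4 : γ * f x ^ (-γ - 1) * -(2 * C * (f x ^ γ * f x)) = -(2 * C * γ) := by
      linear_combination -(2 * C * γ) * h3
    linarith [mul_le_mul_of_nonneg_left h1 h2])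
  -- The integrated inequality f t ^ (-γ) - f 0 ^ (-γ) ≥ 2 C γ t, multiplied by f t ^ γ * f 0 ^ γ.
  have hkey : (1 + 2 * C * γ * f 0 ^ γ * t) * f t ^ γ ≤ f 0 ^ γ := by
    rw [Real.rpow_neg hpos.le, Real.rpow_neg hf0pos.le] at hgrow
    have ha : 0 < f t ^ γ := by positivity
    have hb : 0 < f 0 ^ γ := by positivity
    have := mul_le_mul_of_nonneg_left hgrow (mul_pos ha hb).le
    field_simp at this
    nlinarith
  rw [le_div_iff₀ (Real.rpow_pos_of_pos hD _)]
  have := Real.rpow_le_rpow (by positivity) hkey (one_div_pos.2 hγ).le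
  rw [Real.mul_rpow hD.le (by positivity), ← Real.rpow_mul hpos.le, ← Real.rpow_mul hf0pos.le,
    mul_one_div_cancel hγ.ne', Real.rpow_one, Real.rpow_one] at this
  linarith

end Energy

/-! ### The Poincaré inequality and its best constant -/

section Poincare

open Filter Topology

lemma integral_norm_sq_eq_norm_sq {α F : Type*} [MeasurableSpace α] {μ : Measure α}
    [NormedAddCommGroup F] [InnerProductSpace ℝ F] (f : Lp F 2 μ) :
    ∫ x, ‖f x‖ ^ 2 ∂μ = ‖f‖ ^ 2 := by
  rw [← real_inner_self_eq_norm_sq, L2.inner_def]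
  simp_rw [real_inner_self_eq_norm_sq]

lemma integral_sq_eq_norm_sq {α : Type*} [MeasurableSpace α] {μ : Measure α} (f : Lp ℝ 2 μ) :
    ∫ x, f x ^ 2 ∂μ = ‖f‖ ^ 2 := by
  simp_rw [← integral_norm_sq_eq_norm_sq f, Real.norm_eq_abs, sq_abs]

namespace NonlocalHeat

namespace IsTestFunction

section

variable {F : Type*} [NormedAddCommGroup F] [NormedSpace ℝ F] {U : Set F} {φ : F → ℝ}

lemma eq_zero_of_notMem (hφ : IsTestFunction U φ) {x : F} (hx : x ∉ U) : φ x = 0 :=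
  image_eq_zero_of_notMem_tsupport fun h => hx (hφ.tsupport_subset h)

lemma differentiable (hφ : IsTestFunction U φ) : Differentiable ℝ φ :=
  hφ.smooth.differentiable (by simp)

lemma integrable_of_eq_zero [MeasurableSpace F] [OpensMeasurableSpace F] {μ : Measure F}
    [IsFiniteMeasureOnCompacts μ] (hφ : IsTestFunction U φ) {f : F → ℝ} (hf : Continuous f)
    (h : ∀ x, φ x = 0 → f x = 0) : Integrable f μ :=
  hf.integrable_of_hasCompactSupport (hφ.hasCompactSupport.mono fun x hx hx' => hx (h x hx'))

lemma continuous_fderiv_apply (hφ : IsTestFunction U φ) (v : F) :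
    Continuous fun x => fderiv ℝ φ x v :=
  (hφ.smooth.continuous_fderiv (by simp)).clm_apply continuous_const

end

variable {d : ℕ} {Ω : Set (EuclideanSpace ℝ (Fin d))} {φ ψ : EuclideanSpace ℝ (Fin d) → ℝ}

lemma gradient_eq_zero_of_notMem (hφ : IsTestFunction Ω φ) {x : EuclideanSpace ℝ (Fin d)}
    (hx : x ∉ Ω) : ∇ φ x = 0 := by
  have : fderiv ℝ φ x = 0 := image_eq_zero_of_notMem_tsupport fun h =>
    hx (hφ.tsupport_subset (tsupport_fderiv_subset ℝ h))
  rw [gradient, this, map_zero]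

lemma continuous_gradient (hφ : IsTestFunction Ω φ) : Continuous (∇ φ) :=
  (LinearIsometryEquiv.continuous _).comp (hφ.smooth.continuous_fderiv (by simp))

lemma hasCompactSupport_gradient (hφ : IsTestFunction Ω φ) : HasCompactSupport (∇ φ) :=
  (hφ.hasCompactSupport.fderiv ℝ).comp_left (map_zero _)

lemma memLp (hφ : IsTestFunction Ω φ) : MemLp φ 2 (volume.restrict Ω) :=
  (hφ.smooth.continuous.memLp_of_hasCompactSupport hφ.hasCompactSupport).restrict Ω

lemma memLp_gradient (hφ : IsTestFunction Ω φ) : MemLp (∇ φ) 2 (volume.restrict Ω) :=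
  (hφ.continuous_gradient.memLp_of_hasCompactSupport hφ.hasCompactSupport_gradient).restrict Ω

lemma integral_smul_gradient (hφ : IsTestFunction Ω φ) (hψ : IsTestFunction Ω ψ) :
    ∫ x in Ω, φ x • ∇ ψ x = -∫ x in Ω, ψ x • ∇ φ x := by
  have hint : ∀ {f g : EuclideanSpace ℝ (Fin d) → ℝ}, IsTestFunction Ω f → IsTestFunction Ω g →
      Integrable fun x => f x • ∇ g x := fun hf hg =>
    (hf.smooth.continuous.smul hg.continuous_gradient).integrable_of_hasCompactSupport
      (hf.hasCompactSupport.smul_right)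
  rw [setIntegral_eq_integral_of_forall_compl_eq_zero fun x hx => by
      rw [hφ.eq_zero_of_notMem hx, zero_smul],
    setIntegral_eq_integral_of_forall_compl_eq_zero fun x hx => by
      rw [hψ.eq_zero_of_notMem hx, zero_smul]]
  refine ext_inner_left ℝ fun v => ?_
  rw [inner_neg_right, ← integral_inner (hint hφ hψ), ← integral_inner (hint hψ hφ)]
  simp_rw [inner_smul_right, inner_gradient_right, conj_trivial]
  rw [integral_mul_fderiv_eq_neg_fderiv_mul_of_integrable]
  · simp_rw [mul_comm]
  · exact hψ.integrable_of_eq_zero ((hφ.continuous_fderiv_apply v).mul hψ.smooth.continuous)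
      fun x hx => by rw [hx, mul_zero]
  · exact hφ.integrable_of_eq_zero (hφ.smooth.continuous.mul (hψ.continuous_fderiv_apply v))
      fun x hx => by rw [hx, zero_mul]
  · exact hφ.integrable_of_eq_zero (hφ.smooth.continuous.mul hψ.smooth.continuous)
      fun x hx => by rw [hx, zero_mul]
  · exact fun x _ => hφ.differentiable x
  · exact fun x _ => hψ.differentiable x

lemma toLp_mem_H10 (hφ : IsTestFunction Ω φ) :
    (hφ.memLp.toLp φ, hφ.memLp_gradient.toLp (∇ φ)) ∈ H10 Ω := by
  refine ⟨fun ψ hψ => ?_, subset_closure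
    ⟨φ, hφ, hφ.memLp.coeFn_toLp, hφ.memLp_gradient.coeFn_toLp⟩⟩
  have h1 : ∫ x in Ω, hφ.memLp.toLp φ x • ∇ ψ x = ∫ x in Ω, φ x • ∇ ψ x :=
    integral_congr_ae (by filter_upwards [hφ.memLp.coeFn_toLp] with x hx; rw [hx])
  have h2 : ∫ x in Ω, ψ x • hφ.memLp_gradient.toLp (∇ φ) x = ∫ x in Ω, ψ x • ∇ φ x :=
    integral_congr_ae (by filter_upwards [hφ.memLp_gradient.coeFn_toLp] with x hx; rw [hx])
  rw [h1, h2, hφ.integral_smul_gradient hψ]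

/-- The Poincaré inequality for test functions supported in a ball. -/
lemma integral_sq_le (hd : 1 ≤ d) {R : ℝ} (hR : ∀ x ∈ Ω, ‖x‖ ≤ R) (hφ : IsTestFunction Ω φ) :
    ∫ x in Ω, φ x ^ 2 ≤ 4 * R ^ 2 * ∫ x in Ω, ‖∇ φ x‖ ^ 2 := by
  obtain ⟨e, he⟩ : ∃ e : EuclideanSpace ℝ (Fin d), ‖e‖ = 1 :=
    ⟨EuclideanSpace.single ⟨0, hd⟩ 1, by simp⟩
  obtain ⟨ℓ, hℓ, hℓe⟩ : ∃ ℓ : EuclideanSpace ℝ (Fin d) →L[ℝ] ℝ, (∀ x, |ℓ x| ≤ ‖x‖) ∧ ℓ e = 1 :=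
    ⟨innerSL ℝ e, fun x => by simpa [he] using abs_real_inner_le_norm e x, by simp [he]⟩
  rw [setIntegral_eq_integral_of_forall_compl_eq_zero fun x hx => by
      simp [hφ.eq_zero_of_notMem hx],
    setIntegral_eq_integral_of_forall_compl_eq_zero fun x hx => by
      simp [hφ.gradient_eq_zero_of_notMem hx]]
  have hsq : Integrable fun x => φ x ^ 2 :=
    hφ.integrable_of_eq_zero (hφ.smooth.continuous.pow 2) fun x hx => by simp [hx]
  have hgsq : Integrable fun x => ‖∇ φ x‖ ^ 2 :=
    (hφ.continuous_gradient.norm.pow 2).integrable_of_hasCompactSupport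
      (hφ.hasCompactSupport_gradient.mono fun x hx hx' => hx (by simp [hx']))
  have hfd : ∀ x, fderiv ℝ (fun x => φ x ^ 2) x e = 2 * φ x * fderiv ℝ φ x e := fun x => by
    rw [((hφ.differentiable x).hasFDerivAt.pow 2).fderiv]
    simp
  have hcd := hφ.continuous_fderiv_apply e
  have hcφ := hφ.smooth.continuous
  have hint : Integrable fun x => 2 * φ x * fderiv ℝ φ x e * ℓ x :=
    hφ.integrable_of_eq_zero (((continuous_const.mul hcφ).mul hcd).mul ℓ.continuous)
      fun x hx => by simp [hx]
  -- Integration by parts against the coordinate ℓ, whose derivative along e is 1.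
  have hparts : ∫ x, φ x ^ 2 = -∫ x, 2 * φ x * fderiv ℝ φ x e * ℓ x := by
    have := integral_mul_fderiv_eq_neg_fderiv_mul_of_integrable (μ := volume)
      (f := fun x => φ x ^ 2) (g := ℓ) (v := e) (by simpa only [hfd] using hint)
      (by simpa [hℓe] using hsq)
      (hφ.integrable_of_eq_zero ((hcφ.pow 2).mul ℓ.continuous) fun x hx => by simp [hx])
      (fun x _ => (hφ.differentiable x).pow 2) (fun x _ => ℓ.differentiableAt)
    simpa only [hfd, ContinuousLinearMap.fderiv, hℓe, mul_one] using this
  -- Young's inequality -2ab ≤ a²/2 + 2b² with b = ℓ ∂ₑφ and |ℓ| ≤ R on Ω; absorbing the half on the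
  -- left produces the constant 4R².
  have hle : ∫ x, φ x ^ 2 ≤ ∫ x, (φ x ^ 2 / 2 + 2 * R ^ 2 * ‖∇ φ x‖ ^ 2) := by
    rw [hparts, ← integral_neg]
    refine integral_mono hint.neg ((hsq.div_const 2).add (hgsq.const_mul _)) fun x => ?_
    by_cases hx : x ∈ Ω
    · have h1 : |ℓ x| ≤ R := (hℓ x).trans (hR x hx)
      have h2 : |fderiv ℝ φ x e| ≤ ‖∇ φ x‖ := by
        rw [← inner_gradient_left]
        simpa [he] using abs_real_inner_le_norm (∇ φ x) e
      have h3 : (ℓ x * fderiv ℝ φ x e) ^ 2 ≤ (R * ‖∇ φ x‖) ^ 2 := by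
        have hR0 : 0 ≤ R := (abs_nonneg _).trans h1
        rw [← sq_abs, abs_mul]
        gcongr
      nlinarith [sq_nonneg (φ x + 2 * (ℓ x * fderiv ℝ φ x e))]
    · simp [hφ.eq_zero_of_notMem hx]
      positivity
  rw [integral_add (hsq.div_const 2) (hgsq.const_mul _), integral_div, integral_const_mul] at hle
  linarith

end IsTestFunction

variable {d : ℕ} {Ω : Set (EuclideanSpace ℝ (Fin d))}

lemma norm_sq_le_of_mem_H10 (hd : 1 ≤ d) {R : ℝ} (hR : ∀ x ∈ Ω, ‖x‖ ≤ R)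
    {p : L2 Ω × L2Vec Ω} (hp : p ∈ H10 Ω) : ‖p.1‖ ^ 2 ≤ 4 * R ^ 2 * ‖p.2‖ ^ 2 := by
  have hclosed : IsClosed {p : L2 Ω × L2Vec Ω | ‖p.1‖ ^ 2 ≤ 4 * R ^ 2 * ‖p.2‖ ^ 2} :=
    isClosed_le (by fun_prop) (by fun_prop)
  refine closure_minimal ?_ hclosed hp.2
  rintro q ⟨φ, hφ, h1, h2⟩
  have h3 : ∫ x in Ω, q.1 x ^ 2 = ∫ x in Ω, φ x ^ 2 :=
    integral_congr_ae (by filter_upwards [h1] with x hx; rw [hx])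
  have h4 : ∫ x in Ω, ‖q.2 x‖ ^ 2 = ∫ x in Ω, ‖∇ φ x‖ ^ 2 :=
    integral_congr_ae (by filter_upwards [h2] with x hx; rw [hx])
  rw [mem_ofPred_eq, ← integral_sq_eq_norm_sq, ← integral_norm_sq_eq_norm_sq, h3, h4]
  exact hφ.integral_sq_le hd hR

lemma exists_mem_H10_norm_pos (hΩ : IsOpen Ω) (hne : Ω.Nonempty) :
    ∃ p ∈ H10 Ω, 0 < ‖p.1‖ ^ 2 := by
  obtain ⟨x, hx⟩ := hne
  obtain ⟨φ, hφs, hφc, hφ, -, hφx⟩ :=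
    exists_contDiff_tsupport_subset (n := ⊤) (hΩ.mem_nhds hx)
  have hT : IsTestFunction Ω φ := ⟨hφ, hφc, hφs⟩
  refine ⟨_, hT.toLp_mem_H10, ?_⟩
  rw [← integral_sq_eq_norm_sq, integral_congr_ae (g := fun x => φ x ^ 2),
    setIntegral_eq_integral_of_forall_compl_eq_zero fun x hx => by simp [hT.eq_zero_of_notMem hx]]
  · exact (hφ.continuous.pow 2).integral_pos_of_hasCompactSupport_nonneg_nonzero
      (hφc.comp_left (g := fun y : ℝ => y ^ 2) (by simp)) (fun x => sq_nonneg _) (x := x)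
      (by simp [hφx])
  · filter_upwards [hT.memLp.coeFn_toLp] with x hx
    rw [hx]

lemma poincareConst_eq : poincareConst Ω =
    sSup {C : ℝ | ∀ p ∈ H10 Ω, C * ‖p.1‖ ^ 2 ≤ ‖p.2‖ ^ 2} := by
  simp_rw [poincareConst, integral_sq_eq_norm_sq, integral_norm_sq_eq_norm_sq]

/-- The Rayleigh quotient of one nonzero bump function bounds every admissible constant, so the
`sSup` is not the default value 0 of an unbounded set. -/
lemma bddAbove_poincare (hΩ : IsOpen Ω) (hne : Ω.Nonempty) :
    BddAbove {C : ℝ | ∀ p ∈ H10 Ω, C * ‖p.1‖ ^ 2 ≤ ‖p.2‖ ^ 2} := by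
  obtain ⟨p, hp, hpos⟩ := exists_mem_H10_norm_pos hΩ hne
  exact ⟨‖p.2‖ ^ 2 / ‖p.1‖ ^ 2, fun C hC => (le_div_iff₀ hpos).2 (hC p hp)⟩

lemma poincareConst_pos (hd : 1 ≤ d) (hΩ : IsOpen Ω) (hb : Bornology.IsBounded Ω)
    (hne : Ω.Nonempty) : 0 < poincareConst Ω := by
  obtain ⟨R, hRpos, hR⟩ := hb.exists_pos_norm_le
  rw [poincareConst_eq]
  refine (show (0 : ℝ) < (4 * R ^ 2)⁻¹ by positivity).trans_le
    (le_csSup (bddAbove_poincare hΩ hne) fun p hp => ?_)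
  rw [inv_mul_le_iff₀ (by positivity)]
  exact norm_sq_le_of_mem_H10 hd hR hp

/-- The supremum is itself admissible: for v ≠ 0 the Rayleigh quotient of v bounds all admissible
constants, among them 0, hence also their supremum. -/
lemma poincareConst_mul_norm_sq_le {p : L2 Ω × L2Vec Ω} (hp : p ∈ H10 Ω) :
    poincareConst Ω * ‖p.1‖ ^ 2 ≤ ‖p.2‖ ^ 2 := by
  rw [poincareConst_eq]
  rcases (sq_nonneg ‖p.1‖).eq_or_lt with h | h
  · rw [← h, mul_zero]
    positivity
  · rw [← le_div_iff₀ h]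
    exact csSup_le ⟨0, fun q _ => by rw [zero_mul]; positivity⟩ fun C hC =>
      (le_div_iff₀ h).2 (hC p hp)

end NonlocalHeat

end Poincare

/-! ### Energy inequality and decay of weak solutions -/

section Decay

namespace NonlocalHeat

variable {d : ℕ} {Ω : Set (EuclideanSpace ℝ (Fin d))} {T γ : ℝ}
  {u₀ : EuclideanSpace ℝ (Fin d) → ℝ} {u : ℝ → L2 Ω}

lemma HasWeakTimeDeriv.integrableOn {u' : ℝ → L2 Ω} (h : HasWeakTimeDeriv Ω T u u') :
    IntegrableOn u' (Ioo 0 T) :=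
  h.memLp.integrable (by norm_num)

/-- The energy identity `(∫_Ω u²)' = -2 (∫_Ω u²)^γ ∫_Ω |∇u|²`, combined with the Poincaré
inequality. -/
lemma IsWeakSolution.energy_inequality (hT : 0 < T) (h : IsWeakSolution Ω T γ 0 u₀ u) :
    AbsolutelyContinuousOnInterval (fun t => ‖u t‖ ^ 2) 0 T ∧
    ∀ᵐ t, t ∈ Ioo 0 T → deriv (fun t => ‖u t‖ ^ 2) t ≤
      -(2 * poincareConst Ω * ((‖u t‖ ^ 2) ^ γ * ‖u t‖ ^ 2)) := by
  obtain ⟨hc, -, g, u', hg, hu', heq⟩ := h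
  have hint := hu'.integrableOn
  have hrep := eq_add_integral_of_weakDeriv hT hc hint hu'.integral_eq
  refine ⟨(IntervalIntegrable.absolutelyContinuousOnInterval_of_sub_eq
    ((intervalIntegrable_iff_integrableOn_Ioo_of_le hT.le).2 hint)
    (by rwa [uIcc_of_le hT.le])).norm_sq, ?_⟩
  filter_upwards [ae_hasDerivAt_of_eq_add_integral hT hint hrep,
    (ae_restrict_iff' measurableSet_Ioo).1 heq,
    (ae_restrict_iff' measurableSet_Ioo).1 hg.mem_H10] with t hd ht hmem htT
  -- The test function is w = u(t), allowed for almost every t because then (u t, g t) lies in `H10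
  -- Ω`.
  have hw := ht htT _ (hmem htT)
  have h0 : ∫ x in Ω, (0 : ℝ → L2 Ω) t x * u t x = 0 := by
    refine integral_eq_zero_of_ae ?_
    filter_upwards [Lp.coeFn_zero ℝ 2 (volume.restrict Ω)] with x hx
    rw [Pi.zero_apply, hx, Pi.zero_apply, zero_mul]
  have hu'u : ∫ x in Ω, u' t x * u t x = inner ℝ (u t) (u' t) := by
    rw [L2.inner_def]
    rfl
  have hgg : ∫ x in Ω, inner ℝ (g t x) (g t x) = ‖g t‖ ^ 2 := by
    rw [← real_inner_self_eq_norm_sq, L2.inner_def]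
  simp only [h0, hu'u, hgg, integral_sq_eq_norm_sq] at hw
  rw [(hd htT).norm_sq.deriv]
  have hP := mul_le_mul_of_nonneg_left (poincareConst_mul_norm_sq_le (hmem htT))
    (Real.rpow_nonneg (sq_nonneg ‖u t‖) γ)
  simp only at hP
  linarith

end NonlocalHeat

end Decay

theorem mainTheorem4 {d : ℕ} (hd : 1 ≤ d) (Ω : Set (EuclideanSpace ℝ (Fin d)))
    (hΩ : IsOpen Ω) (hΩb : Bornology.IsBounded Ω) (hΩne : Ω.Nonempty)
    (γ : ℝ) (hγ : 0 < γ) :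
    0 < NonlocalHeat.poincareConst Ω ∧
    ∀ (T : ℝ), 0 < T →
      ∀ (u₀ : EuclideanSpace ℝ (Fin d) → ℝ) (u : ℝ → NonlocalHeat.L2 Ω),
        NonlocalHeat.IsWeakSolution Ω T γ 0 u₀ u →
        ∀ t ∈ Set.Icc 0 T,
          ∫ x in Ω, (u t x) ^ 2 ≤
            (∫ x in Ω, (u₀ x) ^ 2) /
              (1 + 2 * NonlocalHeat.poincareConst Ω * γ * (∫ x in Ω, (u₀ x) ^ 2) ^ γ * t)
                ^ (1 / γ) := by
  have hpos := NonlocalHeat.poincareConst_pos hd hΩ hΩb hΩne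
  refine ⟨hpos, fun T hT u₀ u hu t ht => ?_⟩
  have hu₀ : ∫ x in Ω, u₀ x ^ 2 = ‖u 0‖ ^ 2 := by
    rw [← integral_sq_eq_norm_sq]
    refine integral_congr_ae ?_
    filter_upwards [hu.2.1] with x hx
    rw [hx]
  obtain ⟨hac, hderiv⟩ := hu.energy_inequality hT
  rw [hu₀, integral_sq_eq_norm_sq]
  exact le_div_rpow_of_deriv_le hpos.le hγ hac (fun t => sq_nonneg _) hderiv ht
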